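/- **Setting.** Let $\mathcal H$ be a complex Hilbert space, with inner product linear in the second variable, let $U$ be a unitary operator on $\mathcal H$ and let $\varphi\in\mathcal H$ be a unit vector that is cyclic for $U$, i.e. the closed linear span of $\{U^k\varphi\}_{k\in\mathbb Z}$ is $\mathcal H$. Put $P=\langle\varphi,\cdot\,\rangle\varphi$ and, for $\lambda\in\partial\mathbb D$, $U_\lambda=U[(1-P)+\lambda P]$, which is unitary. Let $\mu_\lambda$ be the spectral measure of $U_\lambda$ and $\varphi$, that is, the measure on $\partial\mathbb D$ with $$\int\frac{w+z}{w-z}\,d\mu_\lambda(w)=\Big\langle\varphi,\frac{U_\lambda+z}{U_\lambda-z}\,\varphi\Big\rangle\qquad(|z|<1),$$ and let $\mu=\mu_1$. A spectral representation of $U_\lambda$ is a unitary map $\mathcal F_\lambda:\mathcal H\to L^2(\partial\mathbb D,d\mu_\lambda)$ with $(\mathcal F_\lambda U_\lambda\psi)(z)=z(\mathcal F_\lambda\psi)(z)$ for all $\psi\in\mathcal H$ and $\mathcal F_\lambda\varphi\equiv1$. Let $f$ be the function on $\mathbb D$ given by $$\Big\langle\varphi,\frac{U+z}{U-z}\,\varphi\Big\rangle=\frac{1+zf(z)}{1-zf(z)},$$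 and for $z_0\in\partial\mathbb D$ let $$G(z_0)=\int\frac{d\mu(w)}{|z_0-w|^2}\in[0,\infty].$$ **Proposition 3.1.** Suppose that $z_0=e^{i\theta_0}\in\partial\mathbb D$ satisfies $G(z_0)<\infty$. Then the limit $\lambda_0=\lim_{r\uparrow1}z_0f(rz_0)$ exists and lies in $\partial\mathbb D$; there is exactly one spectral representation $\mathcal F_{\lambda_0}$ of $U_{\lambda_0}$; and $\mu_{\lambda_0}(\{z_0\})\ne0$, so that elements of $L^2(\partial\mathbb D,d\mu_{\lambda_0})$ have a well-defined value at $z_0$. Moreover, for every $\psi\in\mathcal H$ with $\psi\perp\varphi$, the limit $\lim_{r\uparrow1}\langle\psi,(U-rz_0)^{-1}\varphi\rangle$ exists and $$(\mathcal F_{\lambda_0}\psi)(z_0)=\overline{(1-\lambda_0)z_0}\;\,\overline{\lim_{r\uparrow1}\langle\psi,(U-rz_0)^{-1}\varphi\rangle}.$$ -/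

import Mathlib

open Filter Topology MeasureTheory
open scoped ENNReal ComplexInnerProductSpace CompactlySupported

/-- The unit circle `∂𝔻` carries its Borel σ-algebra. -/
noncomputable instance Circle.instMeasurableSpaceBorel : MeasurableSpace Circle := borel Circle

instance Circle.instBorelSpaceBorel : BorelSpace Circle := ⟨rfl⟩

namespace RankOneUnitary

variable {H : Type*} [NormedAddCommGroup H] [InnerProductSpace ℂ H] [CompleteSpace H]

/-- The orthogonal projection `P = ⟨φ, ·⟩ φ` onto the multiples of the unit vector `φ`. -/
noncomputable def proj (φ : H) : H →L[ℂ] H := InnerProductSpace.rankOne ℂ φ φ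

theorem diag_mem_unitary_aux {A : Type*} [Ring A] [StarRing A] [Algebra ℂ A] [StarModule ℂ A]
    {p : A} (h1 : p * p = p) (h2 : star p = p) {c : ℂ} (h3 : star c * c = 1) :
    (1 - p) + c • p ∈ unitary A := by
  have h4 : c * star c = 1 := by rw [mul_comm, h3]
  have h5 : (c • p) * (star c • p) = p := by rw [smul_mul_smul_comm, h1, h4, one_smul]
  have h6 : (star c • p) * (c • p) = p := by rw [smul_mul_smul_comm, h1, h3, one_smul]
  have h7 : ∀ d : ℂ, (1 - p) * (d • p) = 0 := fun d => by
    rw [mul_smul_comm, sub_mul, one_mul, h1, sub_self, smul_zero]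
  have h8 : ∀ d : ℂ, (d • p) * (1 - p) = 0 := fun d => by
    rw [smul_mul_assoc, mul_sub, mul_one, h1, sub_self, smul_zero]
  have h9 : (1 - p) * (1 - p) = 1 - p := by
    rw [mul_sub, mul_one, sub_mul, one_mul, h1, sub_self, sub_zero]
  have h10 : star ((1 - p) + c • p) = (1 - p) + star c • p := by
    rw [star_add, star_sub, star_one, star_smul, h2]
  rw [Unitary.mem_iff, h10]
  constructor
  · rw [add_mul, mul_add, mul_add, h9, h7, h8, h6, add_zero, zero_add, sub_add_cancel]
  · rw [add_mul, mul_add, mul_add, h9, h7, h8, h5, add_zero, zero_add, sub_add_cancel]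

theorem diag_mem_unitary {φ : H} (hφ : ‖φ‖ = 1) (lam : Circle) :
    (1 - proj φ) + (lam : ℂ) • proj φ ∈ unitary (H →L[ℂ] H) := by
  have hP := InnerProductSpace.isStarProjection_rankOne_self (𝕜 := ℂ) hφ
  refine diag_mem_unitary_aux hP.isIdempotentElem hP.isSelfAdjoint ?_
  simp [← Complex.normSq_eq_conj_mul_self]

/-- The rank one perturbation `U_λ = U [(1 - P) + λ P]`, for `λ ∈ ∂𝔻` and a unit vector `φ`. -/
noncomputable def perturb (U : unitary (H →L[ℂ] H)) {φ : H} (hφ : ‖φ‖ = 1) (lam : Circle) :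
    unitary (H →L[ℂ] H) :=
  U * ⟨(1 - proj φ) + (lam : ℂ) • proj φ, diag_mem_unitary hφ lam⟩

/-- `φ` is cyclic for `V`: the closed linear span of `{V ^ k φ : k ∈ ℤ}` is the whole space. -/
def IsCyclic (V : unitary (H →L[ℂ] H)) (φ : H) : Prop :=
  (Submodule.span ℂ
    (Set.range fun k : ℤ => ((V ^ k : unitary (H →L[ℂ] H)) : H →L[ℂ] H) φ)).topologicalClosure = ⊤

/-- The operator `(V - z)⁻¹`; for unitary `V` and `|z| < 1` the operator `V - z` is invertible. -/
noncomputable def res (V : unitary (H →L[ℂ] H)) (z : ℂ) : H →L[ℂ] H :=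
  Ring.inverse ((V : H →L[ℂ] H) - z • (1 : H →L[ℂ] H))

/-- The Carathéodory function `F_φ(z) = ⟨φ, (V + z) (V - z)⁻¹ φ⟩`. -/
noncomputable def caratheodory (V : unitary (H →L[ℂ] H)) (φ : H) (z : ℂ) : ℂ :=
  ⟪φ, (((V : H →L[ℂ] H) + z • (1 : H →L[ℂ] H)) * res V z) φ⟫

/-- The function `f` with `F_φ(z) = (1 + z f(z)) / (1 - z f(z))`, i.e.
`z f(z) = (F_φ(z) - 1) / (F_φ(z) + 1)`. The right-hand side vanishes at `0`, and `dslope` is its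
quotient by `z`, with the derivative as value at `z = 0`. -/
noncomputable def schur (V : unitary (H →L[ℂ] H)) (φ : H) : ℂ → ℂ :=
  dslope (fun z => (caratheodory V φ z - 1) / (caratheodory V φ z + 1)) 0

theorem isUnit_sub (V : unitary (H →L[ℂ] H)) {z : ℂ} (hz : ‖z‖ < 1) :
    IsUnit ((V : H →L[ℂ] H) - z • (1 : H →L[ℂ] H)) := by
  by_contra h
  have hs : z ∈ spectrum ℂ (V : H →L[ℂ] H) := by
    rw [spectrum.mem_iff, Algebra.algebraMap_eq_smul_one, IsUnit.sub_iff]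
    exact h
  have := spectrum.subset_circle_of_unitary V.2 hs
  rw [mem_sphere_zero_iff_norm] at this
  linarith

theorem caratheodory_add_one_ne_zero (V : unitary (H →L[ℂ] H)) {φ : H} (hφ : ‖φ‖ = 1) {z : ℂ}
    (hz : ‖z‖ < 1) : caratheodory V φ z + 1 ≠ 0 := by
  set χ := res V z φ with hχ
  have h1 : (V : H →L[ℂ] H) χ - z • χ = φ := by
    have := congrArg (fun T : H →L[ℂ] H => T φ) (Ring.mul_inverse_cancel _ (isUnit_sub V hz))
    simpa [hχ, res] using this
  have hnorm : ‖(V : H →L[ℂ] H) χ‖ = ‖χ‖ := by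
    exact (Unitary.linearIsometryEquiv V).norm_map χ
  have h0 : χ ≠ 0 := by
    intro h; rw [h] at h1; simp at h1; rw [← h1] at hφ; simp at hφ
  have h2 : caratheodory V φ z + 1 = 2 * ⟪φ, (V : H →L[ℂ] H) χ⟫ := by
    have h3 : ⟪φ, φ⟫ = 1 := by rw [inner_self_eq_norm_sq_to_K, hφ]; simp
    have h4 : ⟪φ, (V : H →L[ℂ] H) χ⟫ - z * ⟪φ, χ⟫ = 1 := by
      rw [← inner_smul_right, ← inner_sub_right, h1, h3]
    have h5 : caratheodory V φ z = ⟪φ, (V : H →L[ℂ] H) χ⟫ + z * ⟪φ, χ⟫ := by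
      rw [← inner_smul_right, ← inner_add_right]
      rfl
    rw [h5, ← h4]
    ring
  intro h
  rw [h2, mul_eq_zero, or_iff_right two_ne_zero] at h
  nth_rewrite 1 [← h1] at h
  rw [inner_sub_left, inner_smul_left, inner_self_eq_norm_sq_to_K, hnorm, sub_eq_zero] at h
  have h4 := congrArg norm h
  rw [norm_mul] at h4
  have h5 := norm_inner_le_norm (𝕜 := ℂ) χ ((V : H →L[ℂ] H) χ)
  rw [hnorm] at h5
  simp at h4
  have h6 : 0 < ‖χ‖ := norm_pos_iff.mpr h0
  nlinarith [norm_nonneg z, mul_pos h6 h6]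

theorem caratheodory_eq_schur (V : unitary (H →L[ℂ] H)) {φ : H} (hφ : ‖φ‖ = 1) {z : ℂ}
    (hz : ‖z‖ < 1) :
    caratheodory V φ z = (1 + z * schur V φ z) / (1 - z * schur V φ z) := by
  have h0 : caratheodory V φ 0 = 1 := by
    have h := Ring.mul_inverse_cancel _ (isUnit_sub V (z := 0) (by simp))
    simp only [zero_smul, sub_zero] at h
    simp only [caratheodory, res, zero_smul, sub_zero, add_zero, h, one_apply_eq_self]
    rw [inner_self_eq_norm_sq_to_K, hφ]; simp
  have h1 : z * schur V φ z = (caratheodory V φ z - 1) / (caratheodory V φ z + 1) := by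
    have := sub_smul_dslope (fun z => (caratheodory V φ z - 1) / (caratheodory V φ z + 1)) 0 z
    simpa [h0, schur] using this
  have h2 := caratheodory_add_one_ne_zero V hφ hz
  have h3 : 1 - z * schur V φ z = 2 / (caratheodory V φ z + 1) := by
    rw [h1]; field_simp; ring
  rw [h3, h1]; field_simp; ring

theorem isStarNormal_coe (V : unitary (H →L[ℂ] H)) : IsStarNormal (V : H →L[ℂ] H) :=
  ⟨by rw [commute_iff_eq, Unitary.star_mul_self_of_mem V.2, Unitary.mul_star_self_of_mem V.2]⟩

theorem mem_unitSphere_of_mem_spectrum (V : unitary (H →L[ℂ] H))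
    (w : spectrum ℂ (V : H →L[ℂ] H)) : (w : ℂ) ∈ Submonoid.unitSphere ℂ := by
  have h := spectrum.subset_circle_of_unitary V.2 w.2
  simpa [Submonoid.unitSphere] using h

/-- The inclusion of the spectrum of a unitary operator in the unit circle. -/
noncomputable def specIncl (V : unitary (H →L[ℂ] H)) :
    C(spectrum ℂ (V : H →L[ℂ] H), Circle) where
  toFun w := ⟨w, mem_unitSphere_of_mem_spectrum V w⟩
  continuous_toFun := Continuous.subtype_mk continuous_subtype_val _

/-- The continuous functional calculus `g ↦ g(V)` for continuous functions on the circle. -/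
noncomputable def circleCalc (V : unitary (H →L[ℂ] H)) : C(Circle, ℂ) →⋆ₐ[ℂ] (H →L[ℂ] H) :=
  (cfcHom (R := ℂ) (a := (V : H →L[ℂ] H)) (isStarNormal_coe V)).comp
    (ContinuousMap.compStarAlgHom' ℂ ℂ (specIncl V))

/-- A real continuous function on the circle, viewed as a complex one. -/
noncomputable def toComplexMap (g : C_c(Circle, ℝ)) : C(Circle, ℂ) :=
  ⟨fun w => (g w : ℂ), by fun_prop⟩

theorem circleCalc_nonneg (V : unitary (H →L[ℂ] H)) (φ : H) (g : C_c(Circle, ℝ)) (hg : 0 ≤ g) :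
    0 ≤ (⟪φ, circleCalc V (toComplexMap g) φ⟫).re := by
  have hs : toComplexMap g = star (⟨fun w => ((√(g w) : ℝ) : ℂ), by fun_prop⟩ : C(Circle, ℂ)) *
      (⟨fun w => ((√(g w) : ℝ) : ℂ), by fun_prop⟩ : C(Circle, ℂ)) := by
    ext w
    have h : 0 ≤ g w := hg w
    simp [toComplexMap, ← Complex.ofReal_mul, Real.mul_self_sqrt h]
  rw [hs, map_mul, map_star, mul_apply_eq_comp, ContinuousLinearMap.star_eq_adjoint,
    ContinuousLinearMap.adjoint_inner_right]
  exact inner_self_nonneg (𝕜 := ℂ)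

/-- The positive functional `g ↦ ⟨φ, g(V) φ⟩` on real continuous functions on the circle. -/
noncomputable def spectralFunctional (V : unitary (H →L[ℂ] H)) (φ : H) :
    C_c(Circle, ℝ) →ₚ[ℝ] ℝ :=
  PositiveLinearMap.mk₀
    { toFun := fun g => (⟪φ, circleCalc V (toComplexMap g) φ⟫).re
      map_add' := fun g h => by
        have : toComplexMap (g + h) = toComplexMap g + toComplexMap h := by
          ext w; simp [toComplexMap]
        rw [this, map_add, _root_.add_apply, inner_add_right, Complex.add_re]
      map_smul' := fun c g => by
        have : toComplexMap (c • g) = (c : ℂ) • toComplexMap g := by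
          ext w; simp [toComplexMap]
        rw [this, map_smul, _root_.smul_apply, inner_smul_right,
          Complex.re_ofReal_mul]
        rfl }
    (circleCalc_nonneg V φ)

/-- The spectral measure of `V` and `φ`: the measure `μ` on the unit circle with
`∫ g dμ = ⟨φ, g(V) φ⟩` for all continuous `g`; it exists by the Riesz-Markov-Kakutani theorem. -/
noncomputable def spectralMeasure (V : unitary (H →L[ℂ] H)) (φ : H) : Measure Circle :=
  RealRMK.rieszMeasure (spectralFunctional V φ)

instance (V : unitary (H →L[ℂ] H)) (φ : H) : IsFiniteMeasure (spectralMeasure V φ) := by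
  unfold spectralMeasure
  infer_instance

theorem integral_toComplexMap (V : unitary (H →L[ℂ] H)) (φ : H) (g : C_c(Circle, ℝ)) :
    ∫ w, toComplexMap g w ∂spectralMeasure V φ = ⟪φ, circleCalc V (toComplexMap g) φ⟫ := by
  have h1 : ∫ w, toComplexMap g w ∂spectralMeasure V φ =
      ((⟪φ, circleCalc V (toComplexMap g) φ⟫.re : ℝ) : ℂ) := by
    change ∫ w, ((g w : ℝ) : ℂ) ∂spectralMeasure V φ = _
    rw [integral_complex_ofReal]
    exact congrArg _ (RealRMK.integral_rieszMeasure (spectralFunctional V φ) g)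
  have h2 : star (circleCalc V (toComplexMap g)) = circleCalc V (toComplexMap g) := by
    rw [← map_star]
    congr 1
    ext w
    simp [toComplexMap]
  rw [h1, ← Complex.conj_eq_iff_re, inner_conj_symm, ← ContinuousLinearMap.adjoint_inner_right,
    ← ContinuousLinearMap.star_eq_adjoint, h2]

theorem integral_spectralMeasure (V : unitary (H →L[ℂ] H)) (φ : H) (g : C(Circle, ℂ)) :
    ∫ w, g w ∂spectralMeasure V φ = ⟪φ, circleCalc V g φ⟫ := by
  let u : C_c(Circle, ℝ) := ⟨⟨fun w => (g w).re, by fun_prop⟩, HasCompactSupport.of_compactSpace _⟩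
  let v : C_c(Circle, ℝ) := ⟨⟨fun w => (g w).im, by fun_prop⟩, HasCompactSupport.of_compactSpace _⟩
  have hg : g = toComplexMap u + Complex.I • toComplexMap v := by
    ext w
    simp only [ContinuousMap.add_apply, ContinuousMap.smul_apply, smul_eq_mul]
    rw [mul_comm]
    exact (Complex.re_add_im (g w)).symm
  have hi : ∀ h : C(Circle, ℂ), Integrable (fun w => h w) (spectralMeasure V φ) := fun h =>
    h.continuous.integrable_of_hasCompactSupport (HasCompactSupport.of_compactSpace _)
  rw [hg, map_add, map_smul, _root_.add_apply, inner_add_right, _root_.smul_apply,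
    inner_smul_right, ← integral_toComplexMap, ← integral_toComplexMap, ← integral_const_mul,
    ← integral_add (hi _) ((hi _).const_mul _)]
  rfl

/-- The spectral measure is characterized by `∫ (w + z) / (w - z) dμ(w) = F_φ(z)` for `|z| < 1`. -/
theorem integral_poisson_spectralMeasure (V : unitary (H →L[ℂ] H)) (φ : H) {z : ℂ}
    (hz : ‖z‖ < 1) :
    ∫ w : Circle, ((w : ℂ) + z) / ((w : ℂ) - z) ∂spectralMeasure V φ = caratheodory V φ z := by
  have hne : ∀ w : Circle, (w : ℂ) - z ≠ 0 := fun w h => by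
    rw [sub_eq_zero] at h
    rw [← h, Circle.norm_coe] at hz
    exact lt_irrefl _ hz
  let e : C(Circle, ℂ) := ⟨fun w => (w : ℂ), by fun_prop⟩
  let k : C(Circle, ℂ) := ⟨fun w => ((w : ℂ) - z)⁻¹, Continuous.inv₀ (by fun_prop) hne⟩
  have he : circleCalc V e = (V : H →L[ℂ] H) := cfcHom_id (isStarNormal_coe V)
  have hk1 : (e - z • 1) * k = 1 := by
    ext w
    change ((w : ℂ) - z * 1) * ((w : ℂ) - z)⁻¹ = 1
    rw [mul_one, mul_inv_cancel₀ (hne w)]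
  have hk2 : k * (e - z • 1) = 1 := by rw [mul_comm, hk1]
  have hk3 := congrArg (circleCalc V) hk1
  have hk4 := congrArg (circleCalc V) hk2
  simp only [map_mul, map_sub, map_smul, map_one, he] at hk3 hk4
  have hres : res V z = circleCalc V k := Ring.inverse_unit ⟨_, _, hk3, hk4⟩
  have hint := integral_spectralMeasure V φ ((e + z • 1) * k)
  simp only [map_mul, map_add, map_smul, map_one, he] at hint
  rw [caratheodory, hres, ← hint]
  refine integral_congr_ae (ae_of_all _ fun w => ?_)
  change ((w : ℂ) + z) / ((w : ℂ) - z) = ((w : ℂ) + z * 1) * ((w : ℂ) - z)⁻¹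
  rw [mul_one, div_eq_mul_inv]

/-- `G(z₀) = ∫ |z₀ - w|⁻² dμ(w) ∈ [0, ∞]`, where `μ` is the spectral measure of `V` and `φ`. -/
noncomputable def G (V : unitary (H →L[ℂ] H)) (φ : H) (z₀ : Circle) : ℝ≥0∞ :=
  ∫⁻ w : Circle, (‖(z₀ : ℂ) - (w : ℂ)‖ₑ ^ 2)⁻¹ ∂spectralMeasure V φ

/-- A unitary map `ℱ` of `H` onto `L²(∂𝔻, dμ)`, where `μ` is the spectral measure of `V` and `φ`,
is a spectral representation if `(ℱ V ψ)(z) = z (ℱ ψ)(z)` for all `ψ`, and `ℱ φ ≡ 1`. -/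
def IsSpectralRepresentation (V : unitary (H →L[ℂ] H)) (φ : H)
    (ℱ : H ≃ₗᵢ[ℂ] Lp ℂ 2 (spectralMeasure V φ)) : Prop :=
  (∀ ψ : H, ℱ ((V : H →L[ℂ] H) ψ) =ᵐ[spectralMeasure V φ] fun w => (w : ℂ) * ℱ ψ w) ∧
    ℱ φ =ᵐ[spectralMeasure V φ] fun _ => 1

end RankOneUnitary

namespace RankOneUnitary

variable {H : Type*} [NormedAddCommGroup H] [InnerProductSpace ℂ H] [CompleteSpace H]

/-! Finiteness of `G(z₀)` says that `(w - z₀)⁻¹` lies in `L²(μ)`, so in the spectral representation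
of `U` there is a vector `η` with `(U - z₀) η = φ`, and dominated convergence shows that `(U - r
z₀)⁻¹ φ` tends weakly to `η` (`exists_tendsto_inner_res`). With `a = z₀ ⟨φ, η⟩`, unitarity of `U`
forces `Re a = -1/2` (`re_mul_inner_eq`). The Carathéodory function therefore tends to `1 + 2a`, and
`z₀ f(r z₀)` tends to `λ₀ = a / (a + 1)`, of modulus one.

For this value the vector `χ = U η` satisfies `U_λ₀ χ = z₀ χ` (`perturb_apply_eigenvector`). Its
transform lives at the single point `z₀`, so pairing with `χ` reads off values there
(`inner_eigenvector`). Pairing with `φ`, whose transform is `1`, gives the nonzero number `conj (a +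
1)`, hence an atom at `z₀`. Pairing with `ψ ⊥ φ` gives `conj z₀ ⟨η, ψ⟩`. The quotient of the two is
the formula, because `(1 - λ₀)(a + 1) = 1`. -/

/-! ### Cyclic vectors and their stability under the perturbation. -/

theorem inv_apply_self (V : unitary (H →L[ℂ] H)) (x : H) :
    ((V⁻¹ : unitary (H →L[ℂ] H)) : H →L[ℂ] H) ((V : H →L[ℂ] H) x) = x := by
  rw [← mul_apply_eq_comp, ← Submonoid.coe_mul, inv_mul_cancel]
  rfl

theorem apply_inv_self (V : unitary (H →L[ℂ] H)) (x : H) :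
    (V : H →L[ℂ] H) (((V⁻¹ : unitary (H →L[ℂ] H)) : H →L[ℂ] H) x) = x := by
  rw [← mul_apply_eq_comp, ← Submonoid.coe_mul, mul_inv_cancel]
  rfl

theorem zpow_apply_mem (V : unitary (H →L[ℂ] H)) {S : Submodule ℂ H}
    (hV : ∀ x ∈ S, (V : H →L[ℂ] H) x ∈ S)
    (hV' : ∀ x ∈ S, ((V⁻¹ : unitary (H →L[ℂ] H)) : H →L[ℂ] H) x ∈ S) {φ : H} (hφ : φ ∈ S)
    (k : ℤ) : ((V ^ k : unitary (H →L[ℂ] H)) : H →L[ℂ] H) φ ∈ S := by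
  induction k using Int.induction_on with
  | zero => simpa using hφ
  | succ n ih =>
    rw [← mul_self_zpow]
    exact hV _ ih
  | pred n ih =>
    rw [sub_eq_add_neg, add_comm, zpow_add, zpow_neg_one]
    exact hV' _ ih

/-- A closed subspace that contains a cyclic vector and reduces `V` is the whole space. -/
theorem IsCyclic.mem_closure {V : unitary (H →L[ℂ] H)} {φ : H} (hcyc : IsCyclic V φ)
    {S : Submodule ℂ H} (hV : ∀ x ∈ S, (V : H →L[ℂ] H) x ∈ S)
    (hV' : ∀ x ∈ S, ((V⁻¹ : unitary (H →L[ℂ] H)) : H →L[ℂ] H) x ∈ S) (hφ : φ ∈ S) (x : H) :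
    x ∈ S.topologicalClosure := by
  have h : Submodule.span ℂ
      (Set.range fun k : ℤ => ((V ^ k : unitary (H →L[ℂ] H)) : H →L[ℂ] H) φ) ≤ S := by
    rw [Submodule.span_le]
    rintro _ ⟨k, rfl⟩
    exact zpow_apply_mem V hV hV' hφ k
  have h2 := Submodule.topologicalClosure_mono h
  rw [IsCyclic] at hcyc
  exact h2 (hcyc ▸ Submodule.mem_top)

theorem perturb_apply (U : unitary (H →L[ℂ] H)) {φ : H} (hφ : ‖φ‖ = 1) (lam : Circle) (x : H) :
    (perturb U hφ lam : H →L[ℂ] H) x =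
      (U : H →L[ℂ] H) (x + (((lam : ℂ) - 1) * ⟪φ, x⟫) • φ) := by
  have h : ((1 - proj φ) + (lam : ℂ) • proj φ) x = x + (((lam : ℂ) - 1) * ⟪φ, x⟫) • φ := by
    simp only [proj, _root_.add_apply, _root_.sub_apply, _root_.smul_apply, one_apply_eq_self,
      InnerProductSpace.rankOne_apply, smul_smul, sub_mul, one_mul, sub_smul]
    abel
  rw [← h]
  rfl

/-- A cyclic vector stays cyclic under the rank one perturbation in its direction. -/
theorem IsCyclic.perturb {U : unitary (H →L[ℂ] H)} {φ : H} (hcyc : IsCyclic U φ) (hφ : ‖φ‖ = 1)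
    (lam : Circle) : IsCyclic (perturb U hφ lam) φ := by
  have hone : ⟪φ, φ⟫ = 1 := by rw [inner_self_eq_norm_sq_to_K, hφ]; simp
  set V := RankOneUnitary.perturb U hφ lam with hV
  set S := Submodule.span ℂ
    (Set.range fun k : ℤ => ((V ^ k : unitary (H →L[ℂ] H)) : H →L[ℂ] H) φ) with hS
  have hφS : φ ∈ S := Submodule.subset_span ⟨0, by simp⟩
  have hVS : ∀ x ∈ S, (V : H →L[ℂ] H) x ∈ S := by
    intro x hx
    induction hx using Submodule.span_induction with
    | mem x hx =>
      obtain ⟨k, rfl⟩ := hx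
      refine Submodule.subset_span ⟨k + 1, ?_⟩
      simp only [← mul_self_zpow]
      rfl
    | zero => simp
    | add x y _ _ hx hy => rw [map_add]; exact S.add_mem hx hy
    | smul c x _ hx => rw [map_smul]; exact S.smul_mem c hx
  have hVS' : ∀ x ∈ S, ((V⁻¹ : unitary (H →L[ℂ] H)) : H →L[ℂ] H) x ∈ S := by
    intro x hx
    induction hx using Submodule.span_induction with
    | mem x hx =>
      obtain ⟨k, rfl⟩ := hx
      refine Submodule.subset_span ⟨-1 + k, ?_⟩
      simp only [zpow_add, zpow_neg_one]
      rfl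
    | zero => simp
    | add x y _ _ hx hy => rw [map_add]; exact S.add_mem hx hy
    | smul c x _ hx => rw [map_smul]; exact S.smul_mem c hx
  have hlam : (lam : ℂ) ≠ 0 := Circle.coe_ne_zero lam
  -- `U` is in turn the rank one perturbation of `V` with parameter `λ⁻¹`. Together with the
  -- analogous identity for `U⁻¹` this makes `S` reduce `U`, and cyclicity for `U` applies.
  have hU : ∀ x, (U : H →L[ℂ] H) x =
      (V : H →L[ℂ] H) (x + (((lam : ℂ)⁻¹ - 1) * ⟪φ, x⟫) • φ) := by
    intro x
    rw [hV, perturb_apply, inner_add_right, inner_smul_right, hone, add_assoc, ← add_smul]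
    congr 1
    have : ((lam : ℂ)⁻¹ - 1) * ⟪φ, x⟫ +
        ((lam : ℂ) - 1) * (⟪φ, x⟫ + ((lam : ℂ)⁻¹ - 1) * ⟪φ, x⟫ * 1) = 0 := by
      field_simp; ring
    rw [this, zero_smul, add_zero]
  have hU' : ∀ x, ((U⁻¹ : unitary (H →L[ℂ] H)) : H →L[ℂ] H) x =
      ((V⁻¹ : unitary (H →L[ℂ] H)) : H →L[ℂ] H) x +
        (((lam : ℂ) - 1) * ⟪φ, ((V⁻¹ : unitary (H →L[ℂ] H)) : H →L[ℂ] H) x⟫) • φ := by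
    intro x
    have h := perturb_apply U hφ lam (((V⁻¹ : unitary (H →L[ℂ] H)) : H →L[ℂ] H) x)
    rw [← hV, apply_inv_self] at h
    rw [h, inv_apply_self, ← h]
  rw [IsCyclic, ← hS, eq_top_iff]
  intro x _
  refine hcyc.mem_closure (fun y hy => ?_) (fun y hy => ?_) hφS x
  · rw [hU]
    exact hVS _ (S.add_mem hy (S.smul_mem _ hφS))
  · rw [hU']
    exact S.add_mem (hVS' _ hy) (S.smul_mem _ hφS)

/-! ### Multiplication by the coordinate and uniqueness of the spectral representation. -/

theorem memLp_coord_mul {μ : Measure Circle} (f : Lp ℂ 2 μ) :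
    MemLp (fun w : Circle => (w : ℂ) * f w) 2 μ := by
  refine (Lp.memLp f).of_le ?_ (ae_of_all _ fun w => by rw [norm_mul, Circle.norm_coe, one_mul])
  exact (Continuous.aestronglyMeasurable (by fun_prop)).mul (Lp.aestronglyMeasurable f)

/-- Multiplication by the coordinate on `L²` of the circle. -/
noncomputable def coordMul (μ : Measure Circle) : Lp ℂ 2 μ →ₗᵢ[ℂ] Lp ℂ 2 μ where
  toFun f := (memLp_coord_mul f).toLp
  map_add' f g := by
    ext1
    filter_upwards [(memLp_coord_mul (f + g)).coeFn_toLp, (memLp_coord_mul f).coeFn_toLp,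
      (memLp_coord_mul g).coeFn_toLp, Lp.coeFn_add f g,
      Lp.coeFn_add (memLp_coord_mul f).toLp (memLp_coord_mul g).toLp] with w h1 h2 h3 h4 h5
    rw [h1, h5, Pi.add_apply, h2, h3, h4, Pi.add_apply, mul_add]
  map_smul' c f := by
    ext1
    filter_upwards [(memLp_coord_mul (c • f)).coeFn_toLp, (memLp_coord_mul f).coeFn_toLp,
      Lp.coeFn_smul c f, Lp.coeFn_smul c (memLp_coord_mul f).toLp] with w h1 h2 h3 h4
    rw [RingHom.id_apply, h1, h4, Pi.smul_apply, h2, h3, Pi.smul_apply, smul_eq_mul, smul_eq_mul,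
      mul_left_comm]
  norm_map' f := by
    simp only [LinearMap.coe_mk, AddHom.coe_mk, Lp.norm_toLp]
    rw [Lp.norm_def]
    congr 1
    exact eLpNorm_congr_norm_ae (ae_of_all _ fun w => by rw [norm_mul, Circle.norm_coe, one_mul])

theorem coeFn_coordMul {μ : Measure Circle} (f : Lp ℂ 2 μ) :
    coordMul μ f =ᵐ[μ] fun w => (w : ℂ) * f w :=
  (memLp_coord_mul f).coeFn_toLp

theorem IsSpectralRepresentation.map_apply {V : unitary (H →L[ℂ] H)} {φ : H}
    {ℱ : H ≃ₗᵢ[ℂ] Lp ℂ 2 (spectralMeasure V φ)} (hF : IsSpectralRepresentation V φ ℱ) (ψ : H) :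
    ℱ ((V : H →L[ℂ] H) ψ) = coordMul _ (ℱ ψ) :=
  Lp.ext ((hF.1 ψ).trans (coeFn_coordMul _).symm)

/-- The set where the two maps agree is a closed subspace containing `φ`. It is stable under `V` by
intertwining, and under `V⁻¹` because multiplication by the coordinate is injective. -/
theorem IsSpectralRepresentation.unique {V : unitary (H →L[ℂ] H)} {φ : H} (hcyc : IsCyclic V φ)
    {ℱ ℱ' : H ≃ₗᵢ[ℂ] Lp ℂ 2 (spectralMeasure V φ)} (hF : IsSpectralRepresentation V φ ℱ)
    (hF' : IsSpectralRepresentation V φ ℱ') : ℱ = ℱ' := by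
  let S : Submodule ℂ H :=
    LinearMap.eqLocus ℱ.toLinearEquiv.toLinearMap ℱ'.toLinearEquiv.toLinearMap
  have hmem : ∀ x, x ∈ S ↔ ℱ x = ℱ' x := fun x => Iff.rfl
  have hclosed : IsClosed (S : Set H) := isClosed_eq ℱ.continuous ℱ'.continuous
  ext1 x
  rw [← hmem, ← hclosed.submodule_topologicalClosure_eq]
  refine hcyc.mem_closure (fun y hy => ?_) (fun y hy => ?_)
    ((hmem _).2 (Lp.ext (hF.2.trans hF'.2.symm))) x
  · rw [hmem] at hy ⊢
    rw [hF.map_apply, hF'.map_apply, hy]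
  · rw [hmem] at hy ⊢
    apply (coordMul _).injective
    rw [← hF.map_apply, ← hF'.map_apply, apply_inv_self, hy]

/-! ### Existence of the spectral representation. -/

/-- The coordinate function on the circle. -/
noncomputable def coordMap : C(Circle, ℂ) := ⟨fun w => (w : ℂ), by fun_prop⟩

theorem circleCalc_coordMap (V : unitary (H →L[ℂ] H)) :
    circleCalc V coordMap = (V : H →L[ℂ] H) := cfcHom_id (isStarNormal_coe V)

/-- The map `g ↦ g(V) φ` on continuous functions on the circle. -/
noncomputable def calcVector (V : unitary (H →L[ℂ] H)) (φ : H) : C(Circle, ℂ) →ₗ[ℂ] H where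
  toFun g := circleCalc V g φ
  map_add' g h := by rw [map_add, _root_.add_apply]
  map_smul' c g := by rw [map_smul, _root_.smul_apply, RingHom.id_apply]

theorem calcVector_coordMap_mul (V : unitary (H →L[ℂ] H)) (φ : H) (g : C(Circle, ℂ)) :
    calcVector V φ (coordMap * g) = (V : H →L[ℂ] H) (calcVector V φ g) := by
  change circleCalc V (coordMap * g) φ = (V : H →L[ℂ] H) (circleCalc V g φ)
  rw [map_mul, circleCalc_coordMap, mul_apply_eq_comp]

/-- Multiplying `g` by the coordinate or by its conjugate applies `V` or `V⁻¹ = V*` to `g(V) φ`, so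
the range reduces `V`. -/
theorem denseRange_calcVector {V : unitary (H →L[ℂ] H)} {φ : H} (hcyc : IsCyclic V φ) :
    DenseRange (calcVector V φ) := by
  intro x
  refine hcyc.mem_closure (S := LinearMap.range (calcVector V φ)) ?_ ?_ ?_ x
  · rintro _ ⟨g, rfl⟩
    exact ⟨coordMap * g, calcVector_coordMap_mul V φ g⟩
  · rintro _ ⟨g, rfl⟩
    refine ⟨star coordMap * g, ?_⟩
    change circleCalc V (star coordMap * g) φ = _
    rw [map_mul, map_star, circleCalc_coordMap, mul_apply_eq_comp]
    rfl
  · refine ⟨1, ?_⟩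
    change circleCalc V 1 φ = φ
    rw [map_one, one_apply_eq_self]

/-- Both squared norms equal `⟨φ, (ḡ g)(V) φ⟩ = ∫ |g|² dμ`. -/
theorem norm_toLp_eq_norm_calcVector (V : unitary (H →L[ℂ] H)) (φ : H) (g : C(Circle, ℂ)) :
    ‖ContinuousMap.toLp (E := ℂ) 2 (spectralMeasure V φ) ℂ g‖ = ‖calcVector V φ g‖ := by
  have h : ⟪ContinuousMap.toLp (E := ℂ) 2 (spectralMeasure V φ) ℂ g,
      ContinuousMap.toLp (E := ℂ) 2 (spectralMeasure V φ) ℂ g⟫ =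
      ⟪calcVector V φ g, calcVector V φ g⟫ := by
    have h1 := integral_spectralMeasure V φ (star g * g)
    rw [map_mul, map_star, mul_apply_eq_comp, ContinuousLinearMap.star_eq_adjoint,
      ContinuousLinearMap.adjoint_inner_right] at h1
    rw [ContinuousMap.inner_toLp]
    refine Eq.trans ?_ h1
    refine integral_congr_ae (ae_of_all _ fun w => ?_)
    exact mul_comm _ _
  rw [inner_self_eq_norm_sq_to_K, inner_self_eq_norm_sq_to_K] at h
  have h2 : ‖ContinuousMap.toLp (E := ℂ) 2 (spectralMeasure V φ) ℂ g‖ ^ 2 =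
    ‖calcVector V φ g‖ ^ 2 := by exact_mod_cast h
  exact (sq_eq_sq₀ (norm_nonneg _) (norm_nonneg _)).1 h2

/-- The spectral theorem for a unitary operator with a cyclic vector. -/
theorem exists_isSpectralRepresentation {V : unitary (H →L[ℂ] H)} {φ : H}
    (hcyc : IsCyclic V φ) : ∃ ℱ, IsSpectralRepresentation V φ ℱ := by
  set μ := spectralMeasure V φ with hμ
  let T : C(Circle, ℂ) →ₗ[ℂ] Lp ℂ 2 μ := (ContinuousMap.toLp (E := ℂ) 2 μ ℂ).toLinearMap
  have hT : DenseRange T := ContinuousMap.toLp_denseRange ℂ μ ℂ (by simp)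
  have hd := denseRange_calcVector hcyc
  have hn : ∀ g, ‖T (LinearEquiv.refl ℂ C(Circle, ℂ) g)‖ = ‖calcVector V φ g‖ :=
    norm_toLp_eq_norm_calcVector V φ
  -- The unitary extends `g(V) φ ↦ g`; continuous functions are dense on both sides and the norms
  -- agree.
  let ℱ := (LinearEquiv.refl ℂ C(Circle, ℂ)).extendOfIsometry (calcVector V φ) T hd hT hn
  have hF : ∀ g, ℱ (calcVector V φ g) = T g :=
    LinearEquiv.extendOfIsometry_eq (LinearEquiv.refl ℂ C(Circle, ℂ)) _ _ hd hT hn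
  refine ⟨ℱ, fun ψ => ?_, ?_⟩
  · refine Filter.EventuallyEq.trans (Filter.EventuallyEq.of_eq ?_) (coeFn_coordMul (ℱ ψ))
    congr 1
    have hfun : (fun ψ => ℱ ((V : H →L[ℂ] H) ψ)) = fun ψ => coordMul μ (ℱ ψ) := by
      refine hd.equalizer (ℱ.continuous.comp (V : H →L[ℂ] H).continuous)
        ((coordMul μ).continuous.comp ℱ.continuous) (funext fun g => Lp.ext ?_)
      simp only [Function.comp_apply]
      rw [← calcVector_coordMap_mul, hF, hF]
      filter_upwards [coeFn_coordMul (T g), ContinuousMap.coeFn_toLp (𝕜 := ℂ) (p := 2) μ g,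
        ContinuousMap.coeFn_toLp (𝕜 := ℂ) (p := 2) μ (coordMap * g)] with w h1 h2 h3
      rw [h1]
      exact h3.trans (congrArg (fun c => (w : ℂ) * c) h2.symm)
    exact congrArg Subtype.val (congrFun hfun ψ)
  · have h1 : calcVector V φ 1 = φ := by
      change circleCalc V 1 φ = φ
      rw [map_one, one_apply_eq_self]
    have h2 := hF 1
    rw [h1] at h2
    rw [h2]
    exact ContinuousMap.coeFn_toLp (𝕜 := ℂ) (p := 2) μ 1

/-! ### The resolvent at the boundary point. -/

/-- The integrand of `G` is `∞` at `w = z₀`, so a finite integral excludes an atom there. This also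
makes the convention `0⁻¹ = 0` in `ℂ` harmless. -/
theorem ae_ne_of_G_lt_top {V : unitary (H →L[ℂ] H)} {φ : H} {z₀ : Circle} (hG : G V φ z₀ < ∞) :
    ∀ᵐ w : Circle ∂spectralMeasure V φ, (w : ℂ) - z₀ ≠ 0 := by
  have hm : Measurable fun w : Circle => (‖(z₀ : ℂ) - (w : ℂ)‖ₑ ^ 2)⁻¹ := by fun_prop
  filter_upwards [ae_lt_top hm hG.ne] with w hw h
  rw [sub_eq_zero] at h
  simp [h] at hw

theorem memLp_inv_sub_of_G_lt_top {V : unitary (H →L[ℂ] H)} {φ : H} {z₀ : Circle}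
    (hG : G V φ z₀ < ∞) :
    MemLp (fun w : Circle => ((w : ℂ) - z₀)⁻¹) 2 (spectralMeasure V φ) := by
  have hm : Measurable fun w : Circle => ((w : ℂ) - z₀)⁻¹ := by fun_prop
  refine ⟨hm.aestronglyMeasurable, ?_⟩
  rw [eLpNorm_lt_top_iff_lintegral_rpow_enorm_lt_top (by simp) (by simp)]
  refine lt_of_le_of_lt (lintegral_mono_ae ?_) hG
  filter_upwards [ae_ne_of_G_lt_top hG] with w hw
  rw [enorm_inv hw, ENNReal.toReal_ofNat, ENNReal.rpow_ofNat, ENNReal.inv_pow, ← enorm_neg,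
    neg_sub]

theorem sub_smul_res_apply (V : unitary (H →L[ℂ] H)) {z : ℂ} (hz : ‖z‖ < 1) (x : H) :
    (V : H →L[ℂ] H) (res V z x) - z • res V z x = x := by
  have := congrArg (fun T : H →L[ℂ] H => T x) (Ring.mul_inverse_cancel _ (isUnit_sub V hz))
  simpa [res] using this

theorem IsSpectralRepresentation.coeFn_sub_smul {V : unitary (H →L[ℂ] H)} {φ : H}
    {ℱ : H ≃ₗᵢ[ℂ] Lp ℂ 2 (spectralMeasure V φ)} (hF : IsSpectralRepresentation V φ ℱ)
    (z : ℂ) (x : H) : ℱ ((V : H →L[ℂ] H) x - z • x) =ᵐ[spectralMeasure V φ]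
      fun w => ((w : ℂ) - z) * ℱ x w := by
  rw [map_sub, map_smul]
  filter_upwards [Lp.coeFn_sub (ℱ ((V : H →L[ℂ] H) x)) (z • ℱ x), Lp.coeFn_smul z (ℱ x), hF.1 x]
    with w h1 h2 h3
  rw [h1, Pi.sub_apply, h2, h3, Pi.smul_apply, smul_eq_mul, sub_mul]

theorem norm_real_mul_circle_lt_one {r : ℝ} (h0 : 0 ≤ r) (h1 : r < 1) (z₀ : Circle) :
    ‖(r : ℂ) * z₀‖ < 1 := by
  rw [norm_mul, Circle.norm_coe, mul_one, Complex.norm_real, Real.norm_of_nonneg h0]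
  exact h1

/-- Moving from `z₀` to `r z₀` costs `1 - r`, which is at most the distance of `r z₀` from any point
of the circle. The bound supplies a dominating function independent of `r`. -/
theorem norm_sub_le_two_mul_norm_sub {r : ℝ} (h0 : 0 ≤ r) (h1 : r < 1) (w z₀ : Circle) :
    ‖(w : ℂ) - z₀‖ ≤ 2 * ‖(w : ℂ) - r * z₀‖ := by
  have h2 : ‖(w : ℂ)‖ - ‖(r : ℂ) * z₀‖ ≤ ‖(w : ℂ) - r * z₀‖ := norm_sub_norm_le _ _
  have h3 : ‖(w : ℂ) - z₀‖ ≤ ‖(w : ℂ) - r * z₀‖ + ‖(r : ℂ) * z₀ - z₀‖ := by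
    simpa using norm_add_le ((w : ℂ) - r * z₀) ((r : ℂ) * z₀ - z₀)
  have h4 : ‖(r : ℂ) * z₀ - z₀‖ = 1 - r := by
    rw [← sub_one_mul, norm_mul, Circle.norm_coe, mul_one, ← Complex.ofReal_one,
      ← Complex.ofReal_sub, Complex.norm_real, Real.norm_eq_abs, abs_of_neg (by linarith)]
    ring
  rw [norm_mul, Circle.norm_coe, Circle.norm_coe, mul_one, Complex.norm_real,
    Real.norm_of_nonneg h0] at h2
  linarith

/-- If `G(z₀) < ∞`, then `φ` is in the range of `U - z₀`, and `(U - r z₀)⁻¹ φ` converges weakly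
to the preimage as `r ↑ 1`. -/
theorem exists_tendsto_inner_res {U : unitary (H →L[ℂ] H)} {φ : H} (hcyc : IsCyclic U φ)
    {z₀ : Circle} (hG : G U φ z₀ < ∞) :
    ∃ η : H, (U : H →L[ℂ] H) η = (z₀ : ℂ) • η + φ ∧
      ∀ ψ : H, Tendsto (fun r : ℝ => ⟪ψ, res U (r * z₀) φ⟫) (𝓝[<] 1) (𝓝 ⟪ψ, η⟫) := by
  obtain ⟨ℱ, hF⟩ := exists_isSpectralRepresentation hcyc
  have hk := memLp_inv_sub_of_G_lt_top hG
  have hη : ℱ (ℱ.symm hk.toLp) =ᵐ[spectralMeasure U φ] fun w => ((w : ℂ) - z₀)⁻¹ := by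
    rw [ℱ.apply_symm_apply]
    exact hk.coeFn_toLp
  set η := ℱ.symm hk.toLp
  refine ⟨η, ?_, fun ψ => ?_⟩
  · rw [← sub_eq_iff_eq_add']
    apply ℱ.injective
    apply Lp.ext
    filter_upwards [hF.coeFn_sub_smul z₀ η, hη, hF.2, ae_ne_of_G_lt_top hG] with w h1 h2 h3 h4
    rw [h1, h2, h3, mul_inv_cancel₀ h4]
  · have hr : ∀ᶠ r : ℝ in 𝓝[<] 1, 0 ≤ r ∧ r < 1 := by
      filter_upwards [Ioo_mem_nhdsLT (show (0 : ℝ) < 1 by norm_num)] with r h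
      exact ⟨h.1.le, h.2⟩
    have hae : ∀ r : ℝ, 0 ≤ r → r < 1 → ∀ᵐ w ∂spectralMeasure U φ,
        ℱ (res U (r * z₀) φ) w = ((w : ℂ) - r * z₀)⁻¹ := by
      intro r h0 h1
      have h2 := hF.coeFn_sub_smul (r * z₀) (res U (r * z₀) φ)
      rw [sub_smul_res_apply U (norm_real_mul_circle_lt_one h0 h1 z₀)] at h2
      filter_upwards [h2, hF.2] with w h3 h4
      rw [h3] at h4
      exact eq_inv_of_mul_eq_one_right h4
    have hinner : ∀ (x : H) (g : Circle → ℂ), ℱ x =ᵐ[spectralMeasure U φ] g →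
        ∫ w, ⟪ℱ ψ w, g w⟫ ∂spectralMeasure U φ = ⟪ψ, x⟫ := by
      intro x g hx
      rw [← ℱ.inner_map_map ψ, L2.inner_def]
      refine integral_congr_ae ?_
      filter_upwards [hx] with w hw
      rw [hw]
    rw [← hinner η _ hη]
    refine Tendsto.congr' (f₁ := fun r : ℝ =>
      ∫ w : Circle, ⟪ℱ ψ w, ((w : ℂ) - r * z₀)⁻¹⟫ ∂spectralMeasure U φ) ?_ ?_
    · filter_upwards [hr] with r ⟨h0, h1⟩
      exact hinner _ _ (hae r h0 h1)
    refine tendsto_integral_filter_of_dominated_convergence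
      (fun w => ‖ℱ ψ w‖ * (2 * ‖((w : ℂ) - z₀)⁻¹‖)) ?_ ?_ ?_ ?_
    · refine Eventually.of_forall fun r => (Lp.aestronglyMeasurable _).inner ?_
      have hm : Measurable fun w : Circle => ((w : ℂ) - r * z₀)⁻¹ := by fun_prop
      exact hm.aestronglyMeasurable
    · filter_upwards [hr] with r ⟨h0, h1⟩
      filter_upwards [ae_ne_of_G_lt_top hG] with w hne
      refine (norm_inner_le_norm _ _).trans (mul_le_mul_of_nonneg_left ?_ (norm_nonneg _))
      have hle := norm_sub_le_two_mul_norm_sub h0 h1 w z₀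
      have hpos := norm_pos_iff.2 hne
      rw [norm_inv, norm_inv, ← div_eq_mul_inv, inv_eq_one_div,
        div_le_div_iff₀ (by linarith) hpos]
      linarith
    -- The dominating function is a product of two `L²` functions; this is where `G(z₀) < ∞` enters.
    · exact ((Lp.memLp (ℱ ψ)).norm).integrable_mul (q := 2) ((hk.norm).const_mul 2)
    · filter_upwards [ae_ne_of_G_lt_top hG] with w hne
      refine tendsto_nhdsWithin_of_tendsto_nhds ?_
      have hc : ContinuousAt (fun r : ℝ => ⟪ℱ ψ w, ((w : ℂ) - r * z₀)⁻¹⟫) 1 :=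
        continuousAt_const.inner (𝕜 := ℂ) (ContinuousAt.inv₀ (by fun_prop) (by simpa using hne))
      simpa using hc.tendsto

/-! ### Eigenvectors and point values of the transform. -/

/-- The transform of an eigenvector is concentrated at the eigenvalue. -/
theorem IsSpectralRepresentation.ae_eq_zero_of_eigenvector {V : unitary (H →L[ℂ] H)} {φ : H}
    {ℱ : H ≃ₗᵢ[ℂ] Lp ℂ 2 (spectralMeasure V φ)} (hF : IsSpectralRepresentation V φ ℱ)
    {z₀ : Circle} {χ : H} (hχ : (V : H →L[ℂ] H) χ = (z₀ : ℂ) • χ) :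
    ∀ᵐ w ∂spectralMeasure V φ, w ≠ z₀ → ℱ χ w = 0 := by
  have h := hF.coeFn_sub_smul z₀ χ
  rw [hχ, sub_self, map_zero] at h
  filter_upwards [h, Lp.coeFn_zero ℂ 2 (spectralMeasure V φ)] with w h1 h2 hne
  rw [h2, Pi.zero_apply, eq_comm, mul_eq_zero] at h1
  refine h1.resolve_left fun h3 => hne ?_
  exact Circle.ext (sub_eq_zero.1 h3)

/-- The integral for `⟨χ, x⟩` collapses to the point `z₀`. No atom is assumed: without one both
sides vanish, so a nonzero pairing detects an atom. -/
theorem IsSpectralRepresentation.inner_eigenvector {V : unitary (H →L[ℂ] H)} {φ : H}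
    {ℱ : H ≃ₗᵢ[ℂ] Lp ℂ 2 (spectralMeasure V φ)} (hF : IsSpectralRepresentation V φ ℱ)
    {z₀ : Circle} {χ : H} (hχ : (V : H →L[ℂ] H) χ = (z₀ : ℂ) • χ) {x : H} {g : Circle → ℂ}
    (hg : ℱ x =ᵐ[spectralMeasure V φ] g) :
    ⟪χ, x⟫ = (spectralMeasure V φ).real {z₀} * (g z₀ * starRingEnd ℂ (ℱ χ z₀)) := by
  rw [← ℱ.inner_map_map, L2.inner_def]
  have h : (fun w => ⟪ℱ χ w, ℱ x w⟫) =ᵐ[spectralMeasure V φ]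
      Set.indicator {z₀} fun _ => g z₀ * starRingEnd ℂ (ℱ χ z₀) := by
    filter_upwards [hF.ae_eq_zero_of_eigenvector hχ, hg] with w h1 h2
    rcases eq_or_ne w z₀ with rfl | hne
    · rw [Set.indicator_of_mem (Set.mem_singleton _), h2]
      rfl
    · rw [Set.indicator_of_notMem (by simpa using hne), h1 hne, inner_zero_left]
  rw [integral_congr_ae h, integral_indicator_const _ (measurableSet_singleton z₀),
    Complex.real_smul]

/-! ### Boundary limit of the Schur function and the phase `λ₀`. -/

theorem caratheodory_eq_one_add (V : unitary (H →L[ℂ] H)) {φ : H} (hφ : ‖φ‖ = 1) {z : ℂ}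
    (hz : ‖z‖ < 1) : caratheodory V φ z = 1 + 2 * (z * ⟪φ, res V z φ⟫) := by
  have h1 := sub_smul_res_apply V hz φ
  rw [sub_eq_iff_eq_add] at h1
  have h2 : caratheodory V φ z = ⟪φ, (V : H →L[ℂ] H) (res V z φ) + z • res V z φ⟫ := rfl
  rw [h2, h1, inner_add_right, inner_add_right, inner_smul_right, inner_self_eq_norm_sq_to_K, hφ]
  push_cast
  ring

theorem mul_schur_eq (V : unitary (H →L[ℂ] H)) {φ : H} (hφ : ‖φ‖ = 1) (z : ℂ) :
    z * schur V φ z = (caratheodory V φ z - 1) / (caratheodory V φ z + 1) := by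
  have h0 : caratheodory V φ 0 = 1 := by
    simpa using caratheodory_eq_one_add V hφ (z := 0) (by simp)
  have := sub_smul_dslope (fun z => (caratheodory V φ z - 1) / (caratheodory V φ z + 1)) 0 z
  simpa [h0, schur] using this

/-- Expand `‖η‖² = ‖U η‖² = ‖z₀ η + φ‖²`; the terms `‖η‖²` cancel. -/
theorem re_mul_inner_eq {U : unitary (H →L[ℂ] H)} {φ : H} (hφ : ‖φ‖ = 1) {z₀ : Circle} {η : H}
    (hη : (U : H →L[ℂ] H) η = (z₀ : ℂ) • η + φ) :
    ((z₀ : ℂ) * ⟪φ, η⟫).re = -1 / 2 := by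
  have h1 : ‖(z₀ : ℂ) • η + φ‖ = ‖η‖ := by
    rw [← hη]
    exact (Unitary.linearIsometryEquiv U).norm_map η
  have h2 := norm_add_sq (𝕜 := ℂ) ((z₀ : ℂ) • η) φ
  rw [h1, norm_smul, Circle.norm_coe, one_mul, hφ, inner_re_symm, inner_smul_right] at h2
  change _ = _ + 2 * ((z₀ : ℂ) * ⟪φ, η⟫).re + _ at h2
  linarith

/-- The phase `a / (a + 1)` for `Re a = -1/2`. -/
theorem exists_circle_eq_div {a : ℂ} (ha : a.re = -1 / 2) :
    a + 1 ≠ 0 ∧ ∃ lam : Circle, (lam : ℂ) = a / (a + 1) := by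
  have h1 : a + 1 ≠ 0 := by
    intro h
    have := congrArg Complex.re h
    simp only [Complex.add_re, Complex.one_re, Complex.zero_re] at this
    linarith
  refine ⟨h1, ⟨a / (a + 1), ?_⟩, rfl⟩
  have h2 : ‖a‖ = ‖a + 1‖ := by
    rw [← sq_eq_sq₀ (norm_nonneg _) (norm_nonneg _), Complex.sq_norm, Complex.sq_norm,
      Complex.normSq_apply, Complex.normSq_apply]
    simp only [Complex.add_re, Complex.add_im, Complex.one_re, Complex.one_im, ha]
    ring
  rw [← SetLike.mem_coe, Submonoid.coe_unitSphere, mem_sphere_zero_iff_norm, norm_div, h2, div_self (norm_ne_zero_iff.2 h1)]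

theorem tendsto_mul_schur {U : unitary (H →L[ℂ] H)} {φ : H} (hφ : ‖φ‖ = 1) {z₀ : Circle} {a : ℂ}
    (hlim : Tendsto (fun r : ℝ => (z₀ : ℂ) * ⟪φ, res U (r * z₀) φ⟫) (𝓝[<] 1) (𝓝 a))
    (ha : a + 1 ≠ 0) :
    Tendsto (fun r : ℝ => (z₀ : ℂ) * schur U φ (r * z₀)) (𝓝[<] 1) (𝓝 (a / (a + 1))) := by
  have hr : Tendsto (fun r : ℝ => (r : ℂ)) (𝓝[<] 1) (𝓝 1) := by
    have : Continuous fun r : ℝ => (r : ℂ) := by fun_prop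
    simpa using (this.tendsto 1).mono_left nhdsWithin_le_nhds
  have hF : Tendsto (fun r : ℝ => caratheodory U φ (r * z₀)) (𝓝[<] 1) (𝓝 (1 + 2 * (1 * a))) := by
    refine ((tendsto_const_nhds (x := (1 : ℂ))).add
      ((hr.mul hlim).const_mul (2 : ℂ))).congr' ?_
    filter_upwards [Ioo_mem_nhdsLT (show (0 : ℝ) < 1 by norm_num)] with r h
    rw [caratheodory_eq_one_add U hφ (norm_real_mul_circle_lt_one h.1.le h.2 z₀), mul_assoc (r : ℂ)]
  have hne : 1 + 2 * (1 * a) + 1 ≠ 0 := by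
    rw [show 1 + 2 * (1 * a) + 1 = 2 * (a + 1) by ring]
    exact mul_ne_zero two_ne_zero ha
  have hQ := ((hF.sub_const 1).div (hF.add_const 1) hne).div hr one_ne_zero
  have hval : (1 + 2 * (1 * a) - 1) / (1 + 2 * (1 * a) + 1) / 1 = a / (a + 1) := by
    rw [div_one, div_eq_div_iff hne ha]
    ring
  rw [hval] at hQ
  refine hQ.congr' ?_
  filter_upwards [Ioo_mem_nhdsLT (show (0 : ℝ) < 1 by norm_num)] with r h
  have hr0 : (r : ℂ) ≠ 0 := by exact_mod_cast h.1.ne'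
  simp only [Pi.div_apply]
  rw [← mul_schur_eq U hφ, mul_assoc, mul_div_cancel_left₀ _ hr0]

/-- The condition on `λ` makes the perturbation subtract exactly `φ` from `U η`, leaving `z₀ η` for
`U` to act on. -/
theorem perturb_apply_eigenvector {U : unitary (H →L[ℂ] H)} {φ : H} (hφ : ‖φ‖ = 1) {z₀ : Circle}
    {η : H} (hη : (U : H →L[ℂ] H) η = (z₀ : ℂ) • η + φ) {lam : Circle}
    (hlam : (1 - (lam : ℂ)) * ⟪φ, (U : H →L[ℂ] H) η⟫ = 1) :
    (perturb U hφ lam : H →L[ℂ] H) ((U : H →L[ℂ] H) η) = (z₀ : ℂ) • (U : H →L[ℂ] H) η := by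
  have h : ((lam : ℂ) - 1) * ⟪φ, (U : H →L[ℂ] H) η⟫ = -1 := by
    linear_combination -hlam
  rw [perturb_apply, h, neg_one_smul, ← sub_eq_add_neg, ← map_smul]
  congr 1
  rw [hη, add_sub_cancel_right]

end RankOneUnitary

theorem proposition3p1 {H : Type*} [NormedAddCommGroup H] [InnerProductSpace ℂ H]
    [CompleteSpace H] (U : unitary (H →L[ℂ] H)) (φ : H) (hφ : ‖φ‖ = 1)
    (hcyc : RankOneUnitary.IsCyclic U φ) (z₀ : Circle) (hG : RankOneUnitary.G U φ z₀ < ∞) :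
    ∃ lam₀ : Circle,
      Tendsto (fun r : ℝ => (z₀ : ℂ) * RankOneUnitary.schur U φ (r * z₀)) (𝓝[<] 1) (𝓝 lam₀) ∧
      (∃! ℱ, RankOneUnitary.IsSpectralRepresentation
        (RankOneUnitary.perturb U hφ lam₀) φ ℱ) ∧
      RankOneUnitary.spectralMeasure (RankOneUnitary.perturb U hφ lam₀) φ {z₀} ≠ 0 ∧
      ∀ ℱ, RankOneUnitary.IsSpectralRepresentation (RankOneUnitary.perturb U hφ lam₀) φ ℱ →
        ∀ ψ : H, ⟪ψ, φ⟫ = 0 →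
          ∃ L : ℂ, Tendsto (fun r : ℝ => ⟪ψ, RankOneUnitary.res U (r * z₀) φ⟫) (𝓝[<] 1) (𝓝 L) ∧
            ℱ ψ z₀ = starRingEnd ℂ ((1 - lam₀) * z₀) * starRingEnd ℂ L := by
  obtain ⟨η, hη, hlim⟩ := RankOneUnitary.exists_tendsto_inner_res hcyc hG
  obtain ⟨ha, lam, hlam⟩ :=
    RankOneUnitary.exists_circle_eq_div (RankOneUnitary.re_mul_inner_eq hφ hη)
  set a := (z₀ : ℂ) * ⟪φ, η⟫
  have hinner : ⟪φ, (U : H →L[ℂ] H) η⟫ = a + 1 := by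
    rw [hη, inner_add_right, inner_smul_right, inner_self_eq_norm_sq_to_K, hφ]
    simp [a]
  have hone : (1 - (lam : ℂ)) * (a + 1) = 1 := by
    rw [hlam]
    field_simp
    ring
  have hχ := RankOneUnitary.perturb_apply_eigenvector hφ hη (lam := lam) (by rw [hinner, hone])
  have hcyc' := hcyc.perturb hφ lam
  obtain ⟨ℱ₀, hF₀⟩ := RankOneUnitary.exists_isSpectralRepresentation hcyc'
  -- Pairing the eigenvector with `φ` fixes the product of the mass at `z₀` and the conjugate value
  -- of its transform there; neither factor is needed separately.
  have hnorm : ∀ ℱ, RankOneUnitary.IsSpectralRepresentation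
      (RankOneUnitary.perturb U hφ lam) φ ℱ →
      starRingEnd ℂ (a + 1) =
        (RankOneUnitary.spectralMeasure (RankOneUnitary.perturb U hφ lam) φ).real {z₀} *
          starRingEnd ℂ (ℱ ((U : H →L[ℂ] H) η) z₀) := by
    intro ℱ hF
    have h := hF.inner_eigenvector hχ hF.2
    rwa [one_mul, ← inner_conj_symm, hinner] at h
  refine ⟨lam, ?_, ⟨ℱ₀, hF₀, fun ℱ hF => hF.unique hcyc' hF₀⟩, fun h0 => ?_, ?_⟩
  · rw [hlam]
    exact RankOneUnitary.tendsto_mul_schur hφ ((hlim φ).const_mul _) ha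
  · have h := hnorm ℱ₀ hF₀
    rw [measureReal_def, h0, ENNReal.toReal_zero, Complex.ofReal_zero, zero_mul,
      map_eq_zero] at h
    exact ha h
  · intro ℱ hF ψ hψ
    refine ⟨⟪ψ, η⟫, hlim ψ, ?_⟩
    have h1 := hF.inner_eigenvector hχ (ae_eq_refl (ℱ ψ))
    rw [mul_left_comm, ← hnorm ℱ hF, hη, inner_add_left, inner_smul_left, ← inner_conj_symm φ, hψ,
      map_zero, add_zero] at h1
    have h2 := congrArg (starRingEnd ℂ) hone
    rw [map_mul, map_one] at h2
    rw [map_mul, inner_conj_symm, mul_assoc, h1, mul_left_comm, h2, mul_one]
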